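/- Let $S^3=\{(z_1,z_2)\in\mathbb C^2:|z_1|^2+|z_2|^2=1\}$, with contact form $\theta=\frac i2\sum_j(z_jd\bar z_j-\bar z_jdz_j)|_{S^3}$, Reeb field $T=i\sum_j(z_j\partial_{z_j}-\bar z_j\partial_{\bar z_j})$ and $Z_1=\bar z_2\partial_{z_1}-\bar z_1\partial_{z_2}$. For $|t|<1$ the Rossi sphere $S^3_t$ is $S^3$ with this contact form and the complex structure $J_t$ on $\ker\theta$ determined by $J_tZ_1(t)=iZ_1(t)$, $Z_1(t)=(Z_1+t\overline{Z_1})/\sqrt{1-t^2}$. With respect to the coframe $\theta^1(t)=(\theta^1-t\overline{\theta^1})/\sqrt{1-t^2}$, $\theta^1=z_2dz_1-z_1dz_2$, dual to $Z_1(t)$, one has $d\theta^1(t)=\theta^1(t)\wedge\omega_1^1+A_{11}\,\theta\wedge\overline{\theta^1(t)}$ and $d\omega_1^1=W\,\theta^1(t)\wedge\overline{\theta^1(t)}$, where the Tanaka–Webster connection form, the torsion and the Webster curvature are $$\omega_1^1=-\frac{2i(1+t^2)}{1-t^2}\theta,\qquad A_{11}=\frac{4it}{1-t^2},\qquad W=\frac{2(1+t^2)}{1-t^2}.$$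 For a smooth surface $\Sigma\subset S^3_t$, a point $p$ is singular if $T_p\Sigma=\ker\theta_p$. On a surface without singular points let $e_1\in T\Sigma\cap\ker\theta$ have unit length for $\frac12d\theta(\cdot,J_t\cdot)$, let $e_2=J_te_1$, let $e^1,e^2,\theta$ be the coframe dual to $e_1,e_2,T$, and define $\alpha$ and $H$ by $T+\alpha e_2\in T\Sigma$ and $\nabla_{e_1}e_1=He_2$, where $\nabla$ is the Tanaka–Webster connection ($\nabla Z_1(t)=\omega_1^1\otimes Z_1(t)$). With the values of $A_{11}$ and $W$ above, put $$E_1(\Sigma)=\int_\Sigma\Big|e_1(\alpha)+\tfrac12\alpha^2-\operatorname{Im}A_{11}+\tfrac14W+\tfrac16H^2\Big|^{3/2}\,\theta\wedge e^1 ,$$ where $\Sigma$ is oriented by $\theta\wedge e^1$. **Lemma.** Let $-1<t<4-\sqrt{15}$ and let $\Sigma\subset S^3_t$ be a smoothly embedded torus without singular points. Then $E_1(\Sigma)\neq0$. -/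

import Mathlib

open scoped ComplexConjugate

noncomputable section

namespace RossiSphere

/-! ### Differential forms on `ℂ²`

Points of `ℂ²` are pairs `q = (z₁, z₂)`. A real tangent vector is identified with its pair of
`∂/∂z_j`-components: `v = (v₁, v₂)` stands for `∑ v_j ∂/∂z_j + conj v_j ∂/∂z̄_j`. Forms on `S³` are
restrictions of forms on `ℂ²`; restriction commutes with the exterior derivative. -/

/-- The exterior derivative of a 1-form, normalised by `(df ∧ dg)(u, v) = df u dg v - df v dg u`. -/
def extD {E : Type*} [NormedAddCommGroup E] [NormedSpace ℝ E]
    (η : ℂ × ℂ → (ℂ × ℂ →L[ℝ] E)) (q u v : ℂ × ℂ) : E :=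
  fderiv ℝ η q u v - fderiv ℝ η q v u

/-- The wedge product of two complex-valued 1-forms at a point, evaluated on `(u, v)`. -/
def wedge (φ ψ : ℂ × ℂ →L[ℝ] ℂ) (u v : ℂ × ℂ) : ℂ := φ u * ψ v - φ v * ψ u

/-- The 1-form `dz₁`. -/
def dz₁ : ℂ × ℂ →L[ℝ] ℂ := ContinuousLinearMap.fst ℝ ℂ ℂ

/-- The 1-form `dz₂`. -/
def dz₂ : ℂ × ℂ →L[ℝ] ℂ := ContinuousLinearMap.snd ℝ ℂ ℂ

/-- The complex conjugate of a complex-valued 1-form at a point. -/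
def conjForm (φ : ℂ × ℂ →L[ℝ] ℂ) : ℂ × ℂ →L[ℝ] ℂ := (Complex.conjCLE : ℂ →L[ℝ] ℂ).comp φ

/-- A real-valued 1-form at a point, viewed as a complex-valued one. -/
def toComplexForm (φ : ℂ × ℂ →L[ℝ] ℝ) : ℂ × ℂ →L[ℝ] ℂ := Complex.ofRealCLM.comp φ

/-! ### The unit sphere and its contact structure -/

/-- The unit sphere `S³ ⊂ ℂ²`. -/
def sphere : Set (ℂ × ℂ) := {q | ‖q.1‖ ^ 2 + ‖q.2‖ ^ 2 = 1}

/-- The tangent space `T_q S³`: the vectors that are real-orthogonal to `q`. -/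
def tangentSphere (q : ℂ × ℂ) : Submodule ℝ (ℂ × ℂ) where
  carrier := {v | (conj q.1 * v.1 + conj q.2 * v.2).re = 0}
  zero_mem' := by simp
  add_mem' := by
    intro a b ha hb
    simp only [Set.mem_ofPred_eq, Prod.fst_add, Prod.snd_add, mul_add, Complex.add_re] at *
    linarith
  smul_mem' := by
    intro c a ha
    simp only [Set.mem_ofPred_eq, Prod.smul_fst, Prod.smul_snd, mul_smul_comm, Complex.add_re,
      Complex.smul_re, smul_eq_mul] at *
    rw [← mul_add, ha, mul_zero]

/-- The contact form `θ = (i/2) ∑ (z_j dz̄_j - z̄_j dz_j) = ∑ (x_j dy_j - y_j dx_j)`,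
where `z_j = x_j + i y_j`. -/
def θ (q : ℂ × ℂ) : ℂ × ℂ →L[ℝ] ℝ :=
  (q.1.re • Complex.imCLM.comp dz₁ - q.1.im • Complex.reCLM.comp dz₁) +
    (q.2.re • Complex.imCLM.comp dz₂ - q.2.im • Complex.reCLM.comp dz₂)

/-- The contact plane `ξ_q = ker θ_q ⊂ T_q S³`. -/
def contactPlane (q : ℂ × ℂ) : Submodule ℝ (ℂ × ℂ) :=
  tangentSphere q ⊓ LinearMap.ker (θ q : ℂ × ℂ →ₗ[ℝ] ℝ)

/-- The Reeb vector field `T = i (z₁ ∂/∂z₁ + z₂ ∂/∂z₂) + conj`. -/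
def reeb (q : ℂ × ℂ) : ℂ × ℂ := (Complex.I * q.1, Complex.I * q.2)

/-- The coframe `θ¹ = z₂ dz₁ - z₁ dz₂` of the standard CR sphere, dual to
`Z₁ = z̄₂ ∂/∂z₁ - z̄₁ ∂/∂z₂`. -/
def θ₁ (q : ℂ × ℂ) : ℂ × ℂ →L[ℝ] ℂ := q.2 • dz₁ - q.1 • dz₂

/-! ### The Rossi sphere `S³_t` -/

/-- The coframe `θ¹(t) = (θ¹ - t conj θ¹) / √(1 - t²)`, dual to
`Z₁(t) = (Z₁ + t conj Z₁) / √(1 - t²)`. -/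
def θ₁t (t : ℝ) (q : ℂ × ℂ) : ℂ × ℂ →L[ℝ] ℂ :=
  ((1 / √(1 - t ^ 2) : ℝ) : ℂ) • (θ₁ q - (t : ℂ) • conjForm (θ₁ q))

/-- The real horizontal vector `c Z₁(t) + conj (c Z₁(t))` at `q`. Its `Z₁`-component is
`(c + t conj c) / √(1 - t²)`, and `Z₁` has `∂/∂z_j`-components `(z̄₂, -z̄₁)`. -/
def horizontal (t : ℝ) (q : ℂ × ℂ) (c : ℂ) : ℂ × ℂ :=
  (((1 / √(1 - t ^ 2) : ℝ) : ℂ) * (c + t * conj c)) • (conj q.2, -conj q.1)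

/-- The complex structure `J_t` of the contact planes, `J_t Z₁(t) = i Z₁(t)`
(extended by `J_t T = 0`). -/
def J (t : ℝ) (q v : ℂ × ℂ) : ℂ × ℂ := horizontal t q (Complex.I * θ₁t t q v)

/-- The Levi form `½ dθ(·, J_t ·)`. -/
def levi (t : ℝ) (q u v : ℂ × ℂ) : ℝ := 1 / 2 * extD θ q u (J t q v)

/-- The torsion coefficient `A₁₁` of `S³_t` with respect to the coframe `(θ, θ¹(t), conj θ¹(t))`,
i.e. the coefficient of `θ ∧ conj θ¹(t)` in `dθ¹(t)`; see `StructureEquations`. -/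
def A₁₁ (t : ℝ) : ℂ := 4 * Complex.I * t / (1 - t ^ 2)

/-- The Tanaka-Webster connection form `ω₁¹` of `S³_t` with respect to the coframe
`(θ, θ¹(t), conj θ¹(t))`. -/
def ω₁₁ (t : ℝ) (q : ℂ × ℂ) : ℂ × ℂ →L[ℝ] ℂ :=
  (-2 * Complex.I * (1 + t ^ 2) / (1 - t ^ 2)) • toComplexForm (θ q)

/-- The Webster curvature of `S³_t`. -/
def W (t : ℝ) : ℝ := 2 * (1 + t ^ 2) / (1 - t ^ 2)

/-- The structure equations on `S³` that determine the Tanaka-Webster connection form `ω`, the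
torsion coefficient `A` and the Webster curvature `w` with respect to the admissible coframe
`(θ, θ¹(t), conj θ¹(t))`:
`dθ = i θ¹ ∧ conj θ¹`, `dθ¹ = θ¹ ∧ ω + A θ ∧ conj θ¹`, `ω + conj ω = 0` and
`dω = w θ¹ ∧ conj θ¹` modulo `θ`. -/
structure StructureEquations (t : ℝ) (ω : ℂ × ℂ → (ℂ × ℂ →L[ℝ] ℂ)) (A : ℂ) (w : ℝ) : Prop where
  levi_form : ∀ q ∈ sphere, ∀ u ∈ tangentSphere q, ∀ v ∈ tangentSphere q,
    ((extD θ q u v : ℝ) : ℂ) = Complex.I * wedge (θ₁t t q) (conjForm (θ₁t t q)) u v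
  torsion : ∀ q ∈ sphere, ∀ u ∈ tangentSphere q, ∀ v ∈ tangentSphere q,
    extD (θ₁t t) q u v =
      wedge (θ₁t t q) (ω q) u v + A * wedge (toComplexForm (θ q)) (conjForm (θ₁t t q)) u v
  skew : ∀ q ∈ sphere, ∀ u ∈ tangentSphere q, ω q u + conj (ω q u) = 0
  curvature : ∀ q ∈ sphere, ∀ u ∈ contactPlane q, ∀ v ∈ contactPlane q,
    extD ω q u v = w * wedge (θ₁t t q) (conjForm (θ₁t t q)) u v

/-! ### Tori and their moving frames -/

/-- `F : ℝ² → ℂ²` is (the lift to `ℝ²` of) a smooth embedding of the torus `ℝ²/ℤ²` into `S³`. -/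
structure IsEmbeddedTorus (F : ℝ × ℝ → ℂ × ℂ) : Prop where
  smooth : ContDiff ℝ ((⊤ : ℕ∞) : WithTop ℕ∞) F
  periodic_fst : ∀ x y : ℝ, F (x + 1, y) = F (x, y)
  periodic_snd : ∀ x y : ℝ, F (x, y + 1) = F (x, y)
  mem_sphere : ∀ p, F p ∈ sphere
  injOn : Set.InjOn F (Set.Ico (0 : ℝ) 1 ×ˢ Set.Ico (0 : ℝ) 1)
  immersion : ∀ p, Function.Injective (fderiv ℝ F p)

/-- The tangent plane of the surface `F` at `F p`. -/
def tangentPlane (F : ℝ × ℝ → ℂ × ℂ) (p : ℝ × ℝ) : Submodule ℝ (ℂ × ℂ) :=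
  LinearMap.range (fderiv ℝ F p : ℝ × ℝ →ₗ[ℝ] ℂ × ℂ)

/-- The point `F p` of the surface `F` is singular: its tangent plane is the contact plane. -/
def IsSingularPoint (F : ℝ × ℝ → ℂ × ℂ) (p : ℝ × ℝ) : Prop :=
  tangentPlane F p = contactPlane (F p)

/-- The pulled back contact form `F^*θ` at `p`. -/
def pullθ (F : ℝ × ℝ → ℂ × ℂ) (p : ℝ × ℝ) : ℝ × ℝ →L[ℝ] ℝ := (θ (F p)).comp (fderiv ℝ F p)

/-- The coordinate vector `θ(F_x) ∂_y - θ(F_y) ∂_x`, which spans the kernel of `F^*θ` at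
nonsingular points. -/
def charDir (F : ℝ × ℝ → ℂ × ℂ) (p : ℝ × ℝ) : ℝ × ℝ := (-pullθ F p (0, 1), pullθ F p (1, 0))

/-- The coordinate expression of `e₁`: the vector `charDir`, normalised to have length one for the
Levi form. (The unit horizontal tangent vector is unique up to sign. The sign chosen here is the
one for which `θ ∧ e¹` is positive on `(F_x, F_y)`.) -/
def e₁coord (t : ℝ) (F : ℝ × ℝ → ℂ × ℂ) (p : ℝ × ℝ) : ℝ × ℝ :=
  (1 / √(levi t (F p) (fderiv ℝ F p (charDir F p)) (fderiv ℝ F p (charDir F p)))) • charDir F p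

/-- The unit vector `e₁ ∈ TΣ ∩ ker θ`. -/
def e₁ (t : ℝ) (F : ℝ × ℝ → ℂ × ℂ) (p : ℝ × ℝ) : ℂ × ℂ := fderiv ℝ F p (e₁coord t F p)

/-- The vector `e₂ = J_t e₁`. -/
def e₂ (t : ℝ) (F : ℝ × ℝ → ℂ × ℂ) (p : ℝ × ℝ) : ℂ × ℂ := J t (F p) (e₁ t F p)

/-- The coordinate expression of a tangent vector `v` of the surface with `θ(v) = 1`. -/
def transverse (F : ℝ × ℝ → ℂ × ℂ) (p : ℝ × ℝ) : ℝ × ℝ :=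
  (1 / (pullθ F p (1, 0) ^ 2 + pullθ F p (0, 1) ^ 2)) • (pullθ F p (1, 0), pullθ F p (0, 1))

/-- The derivation function `α`, determined by `T + α e₂ ∈ TΣ`: it is the `e₂`-component of any
tangent vector `v` of the surface with `θ(v) = 1`. -/
def α (t : ℝ) (F : ℝ × ℝ → ℂ × ℂ) (p : ℝ × ℝ) : ℝ :=
  levi t (F p) (fderiv ℝ F p (transverse F p)) (e₂ t F p)

/-- The Tanaka-Webster covariant derivative, in the direction with coordinate expression `w`, of a
horizontal vector field `V = b Z₁(t) + conj (b Z₁(t))` along the surface: as `∇Z₁(t) = ω₁¹ ⊗ Z₁(t)`,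
it is `(w(b) + ω₁¹(w) b) Z₁(t) + conj`. -/
def covDeriv (t : ℝ) (F : ℝ × ℝ → ℂ × ℂ) (w : ℝ × ℝ) (V : ℝ × ℝ → ℂ × ℂ) (p : ℝ × ℝ) : ℂ × ℂ :=
  horizontal t (F p) (fderiv ℝ (fun p' => θ₁t t (F p') (V p')) p w +
    ω₁₁ t (F p) (fderiv ℝ F p w) * θ₁t t (F p) (V p))

/-- The `p`-mean curvature `H`, determined by `∇_{e₁} e₁ = H e₂`. -/
def H (t : ℝ) (F : ℝ × ℝ → ℂ × ℂ) (p : ℝ × ℝ) : ℝ :=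
  levi t (F p) (covDeriv t F (e₁coord t F p) (e₁ t F) p) (e₂ t F p)

/-- `H_cr = e₁(α) + ½ α² - Im A₁₁ + ¼ W + ⅙ H²`. -/
def Hcr (t : ℝ) (F : ℝ × ℝ → ℂ × ℂ) (p : ℝ × ℝ) : ℝ :=
  fderiv ℝ (α t F) p (e₁coord t F p) + 1 / 2 * α t F p ^ 2 - (A₁₁ t).im + 1 / 4 * W t +
    1 / 6 * H t F p ^ 2

/-- The 1-form `e¹` of the coframe dual to `(e₁, e₂, T)`, on a tangent vector `v`. -/
def dualE₁ (t : ℝ) (F : ℝ × ℝ → ℂ × ℂ) (p : ℝ × ℝ) (v : ℂ × ℂ) : ℝ := levi t (F p) v (e₁ t F p)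

/-- The 2-form `θ ∧ e¹` on the surface, evaluated on `(F_x, F_y)`. -/
def areaDensity (t : ℝ) (F : ℝ × ℝ → ℂ × ℂ) (p : ℝ × ℝ) : ℝ :=
  θ (F p) (fderiv ℝ F p (1, 0)) * dualE₁ t F p (fderiv ℝ F p (0, 1)) -
    θ (F p) (fderiv ℝ F p (0, 1)) * dualE₁ t F p (fderiv ℝ F p (1, 0))

/-- The energy `E₁ = ∫_Σ |H_cr|^{3/2} θ ∧ e¹`, computed over a fundamental domain of `ℝ²/ℤ²`. -/
def E₁ (t : ℝ) (F : ℝ × ℝ → ℂ × ℂ) : ℝ :=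
  ∫ p in Set.Icc (0 : ℝ) 1 ×ˢ Set.Icc (0 : ℝ) 1, |Hcr t F p| ^ (3 / 2 : ℝ) * areaDensity t F p

/-! ### The structure equations hold -/

lemma scale_sq {t : ℝ} (ht : t ^ 2 < 1) : (((1 / √(1 - t ^ 2) : ℝ) : ℂ)) ^ 2 * (1 - t ^ 2) = 1 := by
  have : (1 / √(1 - t ^ 2)) ^ 2 * (1 - t ^ 2) = 1 := by
    rw [div_pow, Real.sq_sqrt (by linarith)]; field_simp [show (1 - t ^ 2) ≠ 0 by linarith]
  exact_mod_cast this

lemma norm_sq_of_mem {q : ℂ × ℂ} (hq : q ∈ sphere) : q.1 * conj q.1 + q.2 * conj q.2 = 1 := by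
  rw [Complex.mul_conj', Complex.mul_conj']; exact_mod_cast hq

lemma θ_apply (q v : ℂ × ℂ) : θ q v = (conj q.1 * v.1 + conj q.2 * v.2).im := by
  simp [θ, dz₁, dz₂]; ring

lemma extD_of_linear {E : Type*} [NormedAddCommGroup E] [NormedSpace ℝ E]
    (η : ℂ × ℂ → (ℂ × ℂ →L[ℝ] E)) (h1 : ∀ x y, η (x + y) = η x + η y)
    (h2 : ∀ (c : ℝ) x, η (c • x) = c • η x) (q u v : ℂ × ℂ) :
    extD η q u v = η u v - η v u := by
  let L : ℂ × ℂ →ₗ[ℝ] (ℂ × ℂ →L[ℝ] E) := ⟨⟨η, h1⟩, h2⟩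
  have : η = ⇑(LinearMap.toContinuousLinearMap L) := rfl
  unfold extD
  rw [this, ContinuousLinearMap.fderiv]

lemma extD_θ (q u v : ℂ × ℂ) :
    extD θ q u v = 2 * (conj u.1 * v.1 + conj u.2 * v.2).im := by
  rw [extD_of_linear, θ_apply, θ_apply]
  · simp; ring
  · intro x y; ext <;> simp [θ_apply] <;> ring
  · intro c x; ext <;> simp [θ_apply] <;> ring

lemma θ₁t_apply (t : ℝ) (q v : ℂ × ℂ) : θ₁t t q v =
    ((1 / √(1 - t ^ 2) : ℝ) : ℂ) *
      ((q.2 * v.1 - q.1 * v.2) - t * conj (q.2 * v.1 - q.1 * v.2)) := by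
  simp [θ₁t, θ₁, conjForm, dz₁, dz₂]

lemma extD_θ₁t (t : ℝ) (q u v : ℂ × ℂ) : extD (θ₁t t) q u v =
    ((1 / √(1 - t ^ 2) : ℝ) : ℂ) *
      (2 * (u.2 * v.1 - u.1 * v.2) - t * conj (2 * (u.2 * v.1 - u.1 * v.2))) := by
  rw [extD_of_linear, θ₁t_apply, θ₁t_apply]
  · simp only [map_sub, map_mul, Complex.conj_ofNat]; ring
  · intro x y; ext <;> simp [θ₁t_apply] <;> ring
  · intro c x; ext <;> simp [θ₁t_apply] <;> ring

lemma extD_ω₁₁ (t : ℝ) (q u v : ℂ × ℂ) : extD (ω₁₁ t) q u v =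
    (-2 * Complex.I * (1 + t ^ 2) / (1 - t ^ 2)) * ((extD θ q u v : ℝ) : ℂ) := by
  rw [extD_θ, extD_of_linear]
  · simp only [ω₁₁, toComplexForm, smul_apply, smul_eq_mul,
      ContinuousLinearMap.comp_apply, Complex.ofRealCLM_apply, θ_apply]
    rw [← mul_sub, ← Complex.ofReal_sub]
    congr 2
    simp; ring
  · intro x y
    have : θ (x + y) = θ x + θ y := by ext <;> simp [θ_apply] <;> ring
    simp only [ω₁₁, toComplexForm, this, ContinuousLinearMap.comp_add, smul_add]
  · intro c x
    have : θ (c • x) = c • θ x := by ext <;> simp [θ_apply] <;> ring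
    ext v <;> simp [ω₁₁, toComplexForm, this] <;> ring

/-- The splitting of a tangent vector of `S³` into its Reeb part and its horizontal part. -/
lemma tangent_decomp {q v : ℂ × ℂ} (hq : q ∈ sphere) (hv : v ∈ tangentSphere q) :
    v = θ q v • reeb q + θ₁ q v • (conj q.2, -conj q.1) := by
  have hq' := norm_sq_of_mem hq
  have hv' : conj q.1 * v.1 + conj q.2 * v.2 = Complex.I * θ q v := by
    apply Complex.ext
    · have h : (conj q.1 * v.1 + conj q.2 * v.2).re = 0 := hv
      rw [h]; simp
    · simp [θ_apply]
  apply Prod.ext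
  · simp only [reeb, θ₁, dz₁, dz₂, Prod.fst_add, Prod.smul_fst, Complex.real_smul, smul_eq_mul,
      sub_apply, smul_apply,
      ContinuousLinearMap.coe_fst', ContinuousLinearMap.coe_snd']
    linear_combination (-v.1) * hq' + q.1 * hv'
  · simp only [reeb, θ₁, dz₁, dz₂, Prod.snd_add, Prod.smul_snd, Complex.real_smul, smul_eq_mul,
      sub_apply, smul_apply,
      ContinuousLinearMap.coe_fst', ContinuousLinearMap.coe_snd']
    linear_combination (-v.2) * hq' + q.2 * hv'


lemma tangent_inner {q u v : ℂ × ℂ} (hq : q ∈ sphere) (hu : u ∈ tangentSphere q)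
    (hv : v ∈ tangentSphere q) :
    conj u.1 * v.1 + conj u.2 * v.2 = θ q u * θ q v + conj (θ₁ q u) * θ₁ q v := by
  have hq' := norm_sq_of_mem hq
  have h1 := tangent_decomp hq hu
  have h2 := tangent_decomp hq hv
  generalize θ q u = a at *
  generalize θ q v = b at *
  generalize θ₁ q u = c at *
  generalize θ₁ q v = d at *
  subst h1 h2
  simp only [reeb, Prod.fst_add, Prod.snd_add, Prod.smul_fst, Prod.smul_snd, Complex.real_smul,
    smul_eq_mul, map_add, map_mul, map_neg, Complex.conj_conj, Complex.conj_I, Complex.conj_ofReal]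
  linear_combination (a * b + conj c * d) * hq' -
    (a * b * (q.1 * conj q.1 + q.2 * conj q.2)) * Complex.I_sq

lemma tangent_area {q u v : ℂ × ℂ} (hq : q ∈ sphere) (hu : u ∈ tangentSphere q)
    (hv : v ∈ tangentSphere q) :
    u.2 * v.1 - u.1 * v.2 = Complex.I * (θ q u * θ₁ q v - θ q v * θ₁ q u) := by
  have hq' := norm_sq_of_mem hq
  have h1 := tangent_decomp hq hu
  have h2 := tangent_decomp hq hv
  generalize θ q u = a at *
  generalize θ q v = b at *
  generalize θ₁ q u = c at *
  generalize θ₁ q v = d at *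
  subst h1 h2
  simp only [reeb, Prod.fst_add, Prod.snd_add, Prod.smul_fst, Prod.smul_snd, Complex.real_smul,
    smul_eq_mul]
  linear_combination Complex.I * (a * d - b * c) * hq'

lemma extD_θ_eq {t : ℝ} (ht : t ^ 2 < 1) {q u v : ℂ × ℂ} (hq : q ∈ sphere)
    (hu : u ∈ tangentSphere q) (hv : v ∈ tangentSphere q) :
    ((extD θ q u v : ℝ) : ℂ) = Complex.I * wedge (θ₁t t q) (conjForm (θ₁t t q)) u v := by
  have hs := scale_sq ht
  rw [extD_θ, tangent_inner hq hu hv]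
  simp only [wedge, conjForm, θ₁t, smul_apply, sub_apply, smul_eq_mul,
    ContinuousLinearMap.comp_apply, ContinuousLinearEquiv.coe_coe, Complex.conjCLE_apply,
    map_mul, map_sub, Complex.conj_conj, Complex.conj_ofReal]
  generalize θ q u = a at *
  generalize θ q v = b at *
  generalize θ₁ q u = c at *
  generalize θ₁ q v = d at *
  generalize (((1 / √(1 - t ^ 2) : ℝ) : ℂ)) = s at *
  have h : ((2 * ((a : ℂ) * b + conj c * d).im : ℝ) : ℂ) = -Complex.I * (conj c * d - c * conj d) := by
    apply Complex.ext <;> simp <;> ring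
  rw [h]
  linear_combination Complex.I * (conj c * d - c * conj d) * hs

/-- The connection form, the torsion and the curvature of `S³_t` defined above satisfy the structure
equations. -/
theorem structureEquations {t : ℝ} (ht : t ^ 2 < 1) :
    StructureEquations t (ω₁₁ t) (A₁₁ t) (W t) := by
  have hs := scale_sq ht
  have h0 : (1 - (t : ℂ) ^ 2) ≠ 0 := by
    have : (1 - t ^ 2) ≠ 0 := by linarith
    exact_mod_cast this
  refine ⟨fun q hq u hu v hv => extD_θ_eq ht hq hu hv, ?_, ?_, ?_⟩
  · intro q hq u hu v hv
    rw [extD_θ₁t, tangent_area hq hu hv]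
    simp only [wedge, conjForm, θ₁t, ω₁₁, A₁₁, toComplexForm, smul_apply, sub_apply, smul_eq_mul,
      ContinuousLinearMap.comp_apply, ContinuousLinearEquiv.coe_coe, Complex.conjCLE_apply,
      map_mul, map_sub, Complex.conj_conj, Complex.conj_ofReal, Complex.ofRealCLM_apply,
      Complex.conj_I, Complex.conj_ofNat]
    generalize (((1 / √(1 - t ^ 2) : ℝ) : ℂ)) = s at *
    field_simp
    ring
  · intro q _ u _
    have h : ω₁₁ t q u = (((-2 * (1 + t ^ 2) / (1 - t ^ 2) * θ q u : ℝ)) : ℂ) * Complex.I := by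
      simp only [ω₁₁, toComplexForm, smul_apply, smul_eq_mul, ContinuousLinearMap.comp_apply,
        Complex.ofRealCLM_apply]
      push_cast; ring
    rw [h, map_mul, Complex.conj_ofReal, Complex.conj_I]
    ring
  · intro q hq u hu v hv
    rw [extD_ω₁₁, extD_θ_eq ht hq hu.1 hv.1]
    simp only [W]
    push_cast
    linear_combination (-2 * (1 + (t : ℂ) ^ 2) / (1 - (t : ℂ) ^ 2) *
      wedge (θ₁t t q) (conjForm (θ₁t t q)) u v) * Complex.I_sq


/-! ### The moving frame has its defining properties -/

lemma θ₁t_horizontal {t : ℝ} (ht : t ^ 2 < 1) {q : ℂ × ℂ} (hq : q ∈ sphere) (c : ℂ) :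
    θ₁t t q (horizontal t q c) = c := by
  have hs := scale_sq ht
  have hq' := norm_sq_of_mem hq
  rw [θ₁t_apply]
  simp only [horizontal, Prod.smul_fst, Prod.smul_snd, smul_eq_mul, map_mul, map_sub, map_add,
    map_neg, Complex.conj_conj, Complex.conj_ofReal]
  generalize (((1 / √(1 - t ^ 2) : ℝ) : ℂ)) = s at *
  linear_combination (s ^ 2 * (1 - t ^ 2) * c) * hq' + c * hs

lemma horizontal_mem (t : ℝ) (q : ℂ × ℂ) (c : ℂ) : horizontal t q c ∈ contactPlane q := by
  have h : conj q.1 * (horizontal t q c).1 + conj q.2 * (horizontal t q c).2 = 0 := by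
    simp only [horizontal, Prod.smul_fst, Prod.smul_snd, smul_eq_mul]; ring
  refine ⟨?_, ?_⟩
  · change (conj q.1 * (horizontal t q c).1 + conj q.2 * (horizontal t q c).2).re = 0
    rw [h]; rfl
  · change θ q (horizontal t q c) = 0
    rw [θ_apply, h]; rfl

lemma horizontal_θ₁t {t : ℝ} (ht : t ^ 2 < 1) {q v : ℂ × ℂ} (hq : q ∈ sphere)
    (hv : v ∈ contactPlane q) : horizontal t q (θ₁t t q v) = v := by
  have hs := scale_sq ht
  have h0 : θ q v = 0 := hv.2
  have h1 := tangent_decomp hq hv.1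
  rw [h0, zero_smul, zero_add] at h1
  conv_rhs => rw [h1]
  simp only [horizontal, θ₁t, conjForm, smul_apply, sub_apply, smul_eq_mul,
    ContinuousLinearMap.comp_apply, ContinuousLinearEquiv.coe_coe, Complex.conjCLE_apply,
    map_mul, map_sub, Complex.conj_conj, Complex.conj_ofReal]
  congr 1
  generalize (((1 / √(1 - t ^ 2) : ℝ) : ℂ)) = s at *
  linear_combination (θ₁ q v) * hs

lemma levi_eq {t : ℝ} (ht : t ^ 2 < 1) {q u v : ℂ × ℂ} (hq : q ∈ sphere)
    (hu : u ∈ tangentSphere q) : levi t q u v = (θ₁t t q u * conj (θ₁t t q v)).re := by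
  have h := extD_θ_eq ht hq hu (horizontal_mem t q (Complex.I * θ₁t t q v)).1
  have h2 : ((levi t q u v : ℝ) : ℂ) = ((θ₁t t q u * conj (θ₁t t q v)).re : ℝ) := by
    rw [levi, J, Complex.ofReal_mul, h]
    simp only [wedge, conjForm, ContinuousLinearMap.comp_apply, ContinuousLinearEquiv.coe_coe,
      Complex.conjCLE_apply, θ₁t_horizontal ht hq]
    apply Complex.ext <;> simp <;> ring
  exact_mod_cast h2

lemma horizontal_smul (t : ℝ) (q : ℂ × ℂ) (r : ℝ) (c : ℂ) :
    horizontal t q (r * c) = r • horizontal t q c := by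
  apply Prod.ext <;> simp [horizontal] <;> ring

lemma horizontal_sub (t : ℝ) (q : ℂ × ℂ) (c d : ℂ) :
    horizontal t q (c - d) = horizontal t q c - horizontal t q d := by
  apply Prod.ext <;> simp [horizontal] <;> ring

lemma fderiv_mem_tangentSphere {F : ℝ × ℝ → ℂ × ℂ} (hF : IsEmbeddedTorus F) (p w : ℝ × ℝ) :
    fderiv ℝ F p w ∈ tangentSphere (F p) := by
  have hd : DifferentiableAt ℝ F p := (hF.smooth.differentiable (by simp)).differentiableAt
  have h1 := (hd.hasFDerivAt.fst).norm_sq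
  have h2 := (hd.hasFDerivAt.snd).norm_sq
  have h3 := (h1.add h2).unique ((hasFDerivAt_const (1 : ℝ) p).congr_of_eventuallyEq
    (Filter.Eventually.of_forall fun x => hF.mem_sphere x))
  have h4 := congrArg (fun L => L w) h3
  simp [Complex.inner, Complex.mul_re] at h4
  change (conj (F p).1 * _ + conj (F p).2 * _).re = 0
  simp
  linarith

lemma pullθ_ne_zero {F : ℝ × ℝ → ℂ × ℂ} (hF : IsEmbeddedTorus F) {p : ℝ × ℝ}
    (hp : ¬ IsSingularPoint F p) : pullθ F p (1, 0) ^ 2 + pullθ F p (0, 1) ^ 2 ≠ 0 := by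
  intro h
  apply hp
  have hx : pullθ F p (1, 0) = 0 := by nlinarith [sq_nonneg (pullθ F p (1, 0)), sq_nonneg (pullθ F p (0, 1))]
  have hy : pullθ F p (0, 1) = 0 := by nlinarith [sq_nonneg (pullθ F p (1, 0)), sq_nonneg (pullθ F p (0, 1))]
  have hz : ∀ w, θ (F p) (fderiv ℝ F p w) = 0 := by
    intro w
    have hw : w = w.1 • ((1, 0) : ℝ × ℝ) + w.2 • ((0, 1) : ℝ × ℝ) := by ext <;> simp
    change pullθ F p w = 0
    rw [hw, map_add, map_smul, map_smul, hx, hy]; simp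
  have hle : tangentPlane F p ≤ contactPlane (F p) := by
    rintro _ ⟨w, rfl⟩
    exact ⟨fderiv_mem_tangentSphere hF p w, hz w⟩
  apply Submodule.eq_of_le_of_finrank_le hle
  have h2 : Module.finrank ℝ (tangentPlane F p) = 2 := by
    rw [tangentPlane, LinearMap.finrank_range_of_inj (hF.immersion p)]; simp
  rw [h2]
  let L : ℂ →ₗ[ℝ] ℂ × ℂ := (LinearMap.toSpanSingleton ℂ (ℂ × ℂ)
    (conj (F p).2, -conj (F p).1)).restrictScalars ℝ
  have hc : contactPlane (F p) ≤ LinearMap.range L := by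
    intro v hv
    refine ⟨θ₁ (F p) v, ?_⟩
    have h1 := tangent_decomp (hF.mem_sphere p) hv.1
    rw [show θ (F p) v = 0 from hv.2, zero_smul, zero_add] at h1
    exact h1.symm
  calc Module.finrank ℝ (contactPlane (F p)) ≤ Module.finrank ℝ (LinearMap.range L) :=
        Submodule.finrank_mono hc
    _ ≤ Module.finrank ℝ ℂ := LinearMap.finrank_range_le L
    _ = 2 := Complex.finrank_real_complex

lemma charDir_mem {F : ℝ × ℝ → ℂ × ℂ} (hF : IsEmbeddedTorus F) (p : ℝ × ℝ) :
    fderiv ℝ F p (charDir F p) ∈ contactPlane (F p) := by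
  refine ⟨fderiv_mem_tangentSphere hF p _, ?_⟩
  change pullθ F p (charDir F p) = 0
  have hw : charDir F p = (-pullθ F p (0, 1)) • ((1, 0) : ℝ × ℝ) +
      (pullθ F p (1, 0)) • ((0, 1) : ℝ × ℝ) := by ext <;> simp [charDir]
  rw [hw, map_add, map_smul, map_smul]
  simp only [smul_eq_mul]; ring

/-- `e₁` lies in `TΣ`. -/
lemma e₁_mem_tangentPlane (t : ℝ) (F : ℝ × ℝ → ℂ × ℂ) (p : ℝ × ℝ) : e₁ t F p ∈ tangentPlane F p :=
  ⟨_, rfl⟩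

/-- `e₁` is horizontal. -/
lemma e₁_mem_contactPlane {F : ℝ × ℝ → ℂ × ℂ} (hF : IsEmbeddedTorus F) (t : ℝ) (p : ℝ × ℝ) :
    e₁ t F p ∈ contactPlane (F p) := by
  rw [e₁, e₁coord, map_smul]
  exact Submodule.smul_mem _ _ (charDir_mem hF p)

/-- `e₁` has unit length for the Levi form. -/
lemma levi_e₁_e₁ {t : ℝ} (ht : t ^ 2 < 1) {F : ℝ × ℝ → ℂ × ℂ} (hF : IsEmbeddedTorus F) {p : ℝ × ℝ}
    (hp : ¬ IsSingularPoint F p) : levi t (F p) (e₁ t F p) (e₁ t F p) = 1 := by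
  have hm := charDir_mem hF p
  set X := fderiv ℝ F p (charDir F p) with hX
  have hX0 : X ≠ 0 := by
    intro h0
    have h1 : charDir F p = 0 := hF.immersion p (by rw [← hX, h0, map_zero])
    apply pullθ_ne_zero hF hp
    have h2 : -pullθ F p (0, 1) = 0 := congrArg Prod.fst h1
    have h3 : pullθ F p (1, 0) = 0 := congrArg Prod.snd h1
    rw [h3, neg_eq_zero.mp h2]; simp
  have hsq : levi t (F p) X X = ‖θ₁t t (F p) X‖ ^ 2 := by
    rw [levi_eq ht (hF.mem_sphere p) hm.1, Complex.mul_conj']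
    exact_mod_cast rfl
  have hpos : 0 < levi t (F p) X X := by
    rw [hsq]
    have : θ₁t t (F p) X ≠ 0 := by
      intro h
      apply hX0
      rw [← horizontal_θ₁t ht (hF.mem_sphere p) hm, h]
      simp [horizontal]
    positivity
  have he : e₁ t F p = (1 / √(levi t (F p) X X)) • X := by rw [e₁, e₁coord, map_smul]
  rw [levi_eq ht (hF.mem_sphere p) (e₁_mem_contactPlane hF t p).1, he, map_smul]
  rw [levi_eq ht (hF.mem_sphere p) hm.1] at hpos ⊢
  set r := (θ₁t t (F p) X * conj (θ₁t t (F p) X)).re with hr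
  have : ((1 / √r) • θ₁t t (F p) X * conj ((1 / √r) • θ₁t t (F p) X)).re = (1 / √r) ^ 2 * r := by
    rw [hr]; simp; ring
  rw [this, div_pow, Real.sq_sqrt hpos.le]
  field_simp

/-- The defining property of the derivation function: `T + α e₂ ∈ TΣ`. -/
lemma reeb_add_α_smul_e₂_mem {t : ℝ} (ht : t ^ 2 < 1) {F : ℝ × ℝ → ℂ × ℂ} (hF : IsEmbeddedTorus F)
    {p : ℝ × ℝ} (hp : ¬ IsSingularPoint F p) :
    reeb (F p) + α t F p • e₂ t F p ∈ tangentPlane F p := by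
  have hq := hF.mem_sphere p
  set v := fderiv ℝ F p (transverse F p) with hv
  have hvt := fderiv_mem_tangentSphere hF p (transverse F p)
  have hθv : θ (F p) v = 1 := by
    change pullθ F p (transverse F p) = 1
    have h0 := pullθ_ne_zero hF hp
    have hw : transverse F p = (1 / (pullθ F p (1, 0) ^ 2 + pullθ F p (0, 1) ^ 2)) •
        ((pullθ F p (1, 0)) • ((1, 0) : ℝ × ℝ) + (pullθ F p (0, 1)) • ((0, 1) : ℝ × ℝ)) := by
      ext <;> simp [transverse]
    rw [hw, map_smul, map_add, map_smul, map_smul]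
    simp only [smul_eq_mul]
    field_simp
  have hdec := tangent_decomp hq hvt
  rw [← hv, hθv, one_smul] at hdec
  have hhor : v - reeb (F p) = horizontal t (F p) (θ₁t t (F p) v) := by
    have h1 : v - reeb (F p) ∈ contactPlane (F p) := by
      have : v - reeb (F p) = θ₁ (F p) v • (conj (F p).2, -conj (F p).1) := by
        rw [sub_eq_iff_eq_add']; exact hdec
      rw [this]
      have h := norm_sq_of_mem hq
      have h' : ∀ z : ℂ, conj (F p).1 * (z * conj (F p).2) + conj (F p).2 * (z * -conj (F p).1) = 0 :=
        fun z => by ring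
      refine ⟨?_, ?_⟩
      · change (conj (F p).1 * (_ * conj (F p).2) + conj (F p).2 * (_ * -conj (F p).1)).re = 0
        rw [h']; rfl
      · change θ (F p) _ = 0
        rw [θ_apply]
        change (conj (F p).1 * (_ * conj (F p).2) + conj (F p).2 * (_ * -conj (F p).1)).im = 0
        rw [h']; rfl
    rw [← horizontal_θ₁t ht hq h1, map_sub]
    congr 1
    have : θ₁t t (F p) (reeb (F p)) = 0 := by
      rw [θ₁t_apply]
      have h0 : (F p).2 * (reeb (F p)).1 - (F p).1 * (reeb (F p)).2 = 0 := by
        simp only [reeb]; ring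
      rw [h0]; simp
    rw [this, sub_zero]
  set b := θ₁t t (F p) (e₁ t F p) with hb
  have hb1 : (b * conj b).re = 1 := by
    rw [← levi_e₁_e₁ ht hF hp, levi_eq ht hq (e₁_mem_contactPlane hF t p).1]
  have he1 : e₁ t F p = horizontal t (F p) b := (horizontal_θ₁t ht hq (e₁_mem_contactPlane hF t p)).symm
  have he2 : e₂ t F p = horizontal t (F p) (Complex.I * b) := rfl
  have hα : α t F p = (θ₁t t (F p) v * conj (Complex.I * b)).re := by
    rw [α, levi_eq ht hq hvt, he2, θ₁t_horizontal ht hq]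
  have key : reeb (F p) + α t F p • e₂ t F p =
      v - (θ₁t t (F p) v * conj b).re • e₁ t F p := by
    have h1 : α t F p • e₂ t F p = (v - reeb (F p)) - (θ₁t t (F p) v * conj b).re • e₁ t F p := by
      rw [hhor, he2, he1, ← horizontal_smul, ← horizontal_smul, ← horizontal_sub, hα]
      congr 1
      generalize θ₁t t (F p) v = c
      simp at hb1
      apply Complex.ext <;> simp
      · linear_combination c.re * hb1
      · linear_combination c.im * hb1
    rw [h1]; abel
  rw [key]
  exact Submodule.sub_mem _ ⟨_, rfl⟩ (Submodule.smul_mem _ _ (e₁_mem_tangentPlane t F p))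

/-- The defining property of the `p`-mean curvature: `∇_{e₁} e₁ = H e₂`. -/
lemma covDeriv_e₁_e₁ {t : ℝ} (ht : t ^ 2 < 1) {F : ℝ × ℝ → ℂ × ℂ} (hF : IsEmbeddedTorus F)
    (hns : ∀ p, ¬ IsSingularPoint F p) (p : ℝ × ℝ) :
    covDeriv t F (e₁coord t F p) (e₁ t F) p = H t F p • e₂ t F p := by
  have hq := hF.mem_sphere p
  have hb1 : ∀ p', ‖θ₁t t (F p') (e₁ t F p')‖ ^ 2 = 1 := fun p' => by
    have h := levi_e₁_e₁ ht hF (hns p')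
    rw [levi_eq ht (hF.mem_sphere p') (e₁_mem_contactPlane hF t p').1, Complex.mul_conj'] at h
    exact_mod_cast h
  have hω : ω₁₁ t (F p) (fderiv ℝ F p (e₁coord t F p)) = 0 := by
    have h : θ (F p) (e₁ t F p) = 0 := (e₁_mem_contactPlane hF t p).2
    change ω₁₁ t (F p) (e₁ t F p) = 0
    simp [ω₁₁, toComplexForm, h]
  have hcov : covDeriv t F (e₁coord t F p) (e₁ t F) p = horizontal t (F p)
      (fderiv ℝ (fun p' => θ₁t t (F p') (e₁ t F p')) p (e₁coord t F p)) := by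
    rw [covDeriv, hω, zero_mul, add_zero]
  have horth : (fderiv ℝ (fun p' => θ₁t t (F p') (e₁ t F p')) p (e₁coord t F p) *
      conj (θ₁t t (F p) (e₁ t F p))).re = 0 := by
    by_cases hd : DifferentiableAt ℝ (fun p' => θ₁t t (F p') (e₁ t F p')) p
    · have h3 := (hd.hasFDerivAt.norm_sq).unique ((hasFDerivAt_const (1 : ℝ) p).congr_of_eventuallyEq
        (Filter.Eventually.of_forall hb1))
      have h4 := congrArg (fun L => L (e₁coord t F p)) h3
      simp [Complex.inner, Complex.mul_re] at h4
      simp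
      linarith
    · rw [fderiv_zero_of_not_differentiableAt hd]; simp
  have he2 : e₂ t F p = horizontal t (F p) (Complex.I * θ₁t t (F p) (e₁ t F p)) := rfl
  have hH : H t F p = (fderiv ℝ (fun p' => θ₁t t (F p') (e₁ t F p')) p (e₁coord t F p) *
      conj (Complex.I * θ₁t t (F p) (e₁ t F p))).re := by
    rw [H, hcov, levi_eq ht hq (horizontal_mem t (F p) _).1, he2, θ₁t_horizontal ht hq,
      θ₁t_horizontal ht hq]
  rw [hcov, hH, he2, ← horizontal_smul]
  congr 1
  have hb := hb1 p
  rw [← Complex.normSq_eq_norm_sq, Complex.normSq_apply] at hb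
  generalize fderiv ℝ (fun p' => θ₁t t (F p') (e₁ t F p')) p (e₁coord t F p) = c at *
  generalize θ₁t t (F p) (e₁ t F p) = b at *
  simp at horth
  apply Complex.ext <;> simp
  · linear_combination (-c.re) * hb + b.re * horth
  · linear_combination (-c.im) * hb + b.im * horth

end RossiSphere

end

namespace RossiSphere

open MeasureTheory

/-! The function `α` is smooth and doubly periodic, so it attains its maximum over the plane at some
point `p`. There `dα = 0`, hence `e₁(α) = 0`, and `Hcr` reduces to `½ α² + ⅙ H² + (¼ W - Im A₁₁)`.
The constant in parentheses is `(1 + t² - 8t) / (2(1 - t²))`, which for `|t| < 1` is positive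
exactly when `t < 4 - √15`, the smaller root of `t² - 8t + 1`. So `Hcr` is positive at `p`. On the
other hand, `E₁ = 0` forces `Hcr = 0` on the whole fundamental square, because the integrand is
continuous and nonnegative and the density of `θ ∧ e¹` is strictly positive. The maximum is
`exists_α_max`, the passage from the integral to pointwise vanishing is `Hcr_eq_zero_of_E₁_eq_zero`,
and the weight is controlled by `areaDensity_pos`. The smoothness lemmas provide the continuity that
both arguments need. -/

/-! ### Smooth dependence of the ambient tensors on base point and vectors. -/

lemma contDiff_θ_apply {n : WithTop ℕ∞} {q v : ℝ × ℝ → ℂ × ℂ} (hq : ContDiff ℝ n q)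
    (hv : ContDiff ℝ n v) : ContDiff ℝ n fun p => θ (q p) (v p) := by
  simp only [θ_apply]
  have hc : ∀ {f : ℝ × ℝ → ℂ}, ContDiff ℝ n f → ContDiff ℝ n fun p => conj (f p) :=
    fun hf => Complex.conjCLE.contDiff.comp hf
  exact Complex.imCLM.contDiff.comp
    (((hc hq.fst).mul hv.fst).add ((hc hq.snd).mul hv.snd))

lemma contDiff_θ₁t_apply {n : WithTop ℕ∞} (t : ℝ) {q v : ℝ × ℝ → ℂ × ℂ} (hq : ContDiff ℝ n q)
    (hv : ContDiff ℝ n v) : ContDiff ℝ n fun p => θ₁t t (q p) (v p) := by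
  simp only [θ₁t_apply]
  have h := (hq.snd.mul hv.fst).sub (hq.fst.mul hv.snd)
  exact contDiff_const.mul (h.sub (contDiff_const.mul (Complex.conjCLE.contDiff.comp h)))

lemma contDiff_horizontal {n : WithTop ℕ∞} (t : ℝ) {q : ℝ × ℝ → ℂ × ℂ} {c : ℝ × ℝ → ℂ}
    (hq : ContDiff ℝ n q) (hc : ContDiff ℝ n c) :
    ContDiff ℝ n fun p => horizontal t (q p) (c p) := by
  have h : ContDiff ℝ n fun p => ((1 / √(1 - t ^ 2) : ℝ) : ℂ) * (c p + t * conj (c p)) :=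
    contDiff_const.mul (hc.add (contDiff_const.mul (Complex.conjCLE.contDiff.comp hc)))
  exact (h.mul (Complex.conjCLE.contDiff.comp hq.snd)).prodMk
    (h.mul (Complex.conjCLE.contDiff.comp hq.fst).neg)

lemma contDiff_J {n : WithTop ℕ∞} (t : ℝ) {q v : ℝ × ℝ → ℂ × ℂ} (hq : ContDiff ℝ n q)
    (hv : ContDiff ℝ n v) : ContDiff ℝ n fun p => J t (q p) (v p) :=
  contDiff_horizontal t hq (contDiff_const.mul (contDiff_θ₁t_apply t hq hv))

lemma contDiff_levi {n : WithTop ℕ∞} (t : ℝ) {q u v : ℝ × ℝ → ℂ × ℂ} (hq : ContDiff ℝ n q)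
    (hu : ContDiff ℝ n u) (hv : ContDiff ℝ n v) :
    ContDiff ℝ n fun p => levi t (q p) (u p) (v p) := by
  -- Up to the factor 2, `dθ(u, w)` is the same expression as `θ` at base point `u` applied to `w`,
  -- so smoothness of `θ` can be reused with `u` as base point.
  simp only [levi, extD_θ, ← θ_apply]
  exact contDiff_const.mul (contDiff_const.mul (contDiff_θ_apply hu (contDiff_J t hq hv)))

/-! ### Smoothness of the moving frame and of the invariants `α`, `H`, `Hcr`. -/

section Frame

variable {F : ℝ × ℝ → ℂ × ℂ} {t : ℝ}

lemma IsEmbeddedTorus.contDiff_fderiv (hF : IsEmbeddedTorus F) :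
    ContDiff ℝ ((⊤ : ℕ∞) : WithTop ℕ∞) (fderiv ℝ F) :=
  hF.smooth.fderiv_right (by simp)

lemma IsEmbeddedTorus.contDiff_fderiv_apply (hF : IsEmbeddedTorus F) {w : ℝ × ℝ → ℝ × ℝ}
    (hw : ContDiff ℝ ((⊤ : ℕ∞) : WithTop ℕ∞) w) :
    ContDiff ℝ ((⊤ : ℕ∞) : WithTop ℕ∞) fun p => fderiv ℝ F p (w p) :=
  hF.contDiff_fderiv.clm_apply hw

lemma contDiff_pullθ (hF : IsEmbeddedTorus F) (w : ℝ × ℝ) :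
    ContDiff ℝ ((⊤ : ℕ∞) : WithTop ℕ∞) fun p => pullθ F p w :=
  contDiff_θ_apply hF.smooth (hF.contDiff_fderiv_apply contDiff_const)

lemma contDiff_charDir (hF : IsEmbeddedTorus F) :
    ContDiff ℝ ((⊤ : ℕ∞) : WithTop ℕ∞) (charDir F) :=
  (contDiff_pullθ hF _).neg.prodMk (contDiff_pullθ hF _)

/-- This keeps the square root in `e₁coord` away from zero, which makes the normalisation smooth and
the area density positive. -/
lemma levi_charDir_pos (ht : t ^ 2 < 1) (hF : IsEmbeddedTorus F) {p : ℝ × ℝ}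
    (hp : ¬ IsSingularPoint F p) :
    0 < levi t (F p) (fderiv ℝ F p (charDir F p)) (fderiv ℝ F p (charDir F p)) := by
  have h := levi_e₁_e₁ ht hF hp
  by_contra hn
  -- If the Levi length were not positive, the conventions `√x = 0` for `x ≤ 0` and `1 / 0 = 0`
  -- would give `e₁ = 0`, contradicting its unit length.
  rw [e₁, e₁coord, Real.sqrt_eq_zero_of_nonpos (not_lt.mp hn), div_zero, zero_smul, map_zero,
    levi, extD_θ] at h
  simp at h

lemma contDiff_e₁coord (ht : t ^ 2 < 1) (hF : IsEmbeddedTorus F)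
    (hns : ∀ p, ¬ IsSingularPoint F p) :
    ContDiff ℝ ((⊤ : ℕ∞) : WithTop ℕ∞) (e₁coord t F) := by
  have hX := hF.contDiff_fderiv_apply (contDiff_charDir hF)
  have hpos := fun p => levi_charDir_pos ht hF (hns p)
  refine ContDiff.smul (contDiff_const.div
    ((contDiff_levi t hF.smooth hX hX).sqrt fun p => (hpos p).ne') fun p => ?_)
    (contDiff_charDir hF)
  exact (Real.sqrt_pos.mpr (hpos p)).ne'

lemma contDiff_e₁ (ht : t ^ 2 < 1) (hF : IsEmbeddedTorus F)
    (hns : ∀ p, ¬ IsSingularPoint F p) :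
    ContDiff ℝ ((⊤ : ℕ∞) : WithTop ℕ∞) (e₁ t F) :=
  hF.contDiff_fderiv_apply (contDiff_e₁coord ht hF hns)

lemma contDiff_e₂ (ht : t ^ 2 < 1) (hF : IsEmbeddedTorus F)
    (hns : ∀ p, ¬ IsSingularPoint F p) :
    ContDiff ℝ ((⊤ : ℕ∞) : WithTop ℕ∞) (e₂ t F) :=
  contDiff_J t hF.smooth (contDiff_e₁ ht hF hns)

lemma contDiff_α (ht : t ^ 2 < 1) (hF : IsEmbeddedTorus F)
    (hns : ∀ p, ¬ IsSingularPoint F p) :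
    ContDiff ℝ ((⊤ : ℕ∞) : WithTop ℕ∞) (α t F) := by
  have hx := contDiff_pullθ hF (1, 0)
  have hy := contDiff_pullθ hF (0, 1)
  have htr : ContDiff ℝ ((⊤ : ℕ∞) : WithTop ℕ∞) (transverse F) :=
    (contDiff_const.div ((hx.pow 2).add (hy.pow 2)) fun p => pullθ_ne_zero hF (hns p)).smul
      (hx.prodMk hy)
  exact contDiff_levi t hF.smooth (hF.contDiff_fderiv_apply htr) (contDiff_e₂ ht hF hns)

lemma contDiff_H (ht : t ^ 2 < 1) (hF : IsEmbeddedTorus F)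
    (hns : ∀ p, ¬ IsSingularPoint F p) :
    ContDiff ℝ ((⊤ : ℕ∞) : WithTop ℕ∞) (H t F) := by
  have he := contDiff_e₁ ht hF hns
  have hb := contDiff_θ₁t_apply t hF.smooth he
  have hω : ContDiff ℝ ((⊤ : ℕ∞) : WithTop ℕ∞) fun p =>
      ω₁₁ t (F p) (fderiv ℝ F p (e₁coord t F p)) :=
    contDiff_const.mul (Complex.ofRealCLM.contDiff.comp (contDiff_θ_apply hF.smooth he))
  have hd : ContDiff ℝ ((⊤ : ℕ∞) : WithTop ℕ∞) fun p =>
      fderiv ℝ (fun p' => θ₁t t (F p') (e₁ t F p')) p (e₁coord t F p) :=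
    (hb.fderiv_right (by simp)).clm_apply (contDiff_e₁coord ht hF hns)
  exact contDiff_levi t hF.smooth
    (contDiff_horizontal t hF.smooth (hd.add (hω.mul hb))) (contDiff_e₂ ht hF hns)

lemma continuous_Hcr (ht : t ^ 2 < 1) (hF : IsEmbeddedTorus F)
    (hns : ∀ p, ¬ IsSingularPoint F p) : Continuous (Hcr t F) := by
  have hα := contDiff_α ht hF hns
  have h1 : Continuous fun p => fderiv ℝ (α t F) p (e₁coord t F p) :=
    (hα.continuous_fderiv (by simp)).clm_apply (contDiff_e₁coord ht hF hns).continuous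
  have h2 := hα.continuous
  have h3 := (contDiff_H ht hF hns).continuous
  unfold Hcr
  fun_prop

lemma continuous_areaDensity (ht : t ^ 2 < 1) (hF : IsEmbeddedTorus F)
    (hns : ∀ p, ¬ IsSingularPoint F p) : Continuous (areaDensity t F) := by
  have hl := fun w : ℝ × ℝ => (contDiff_levi t hF.smooth
    (hF.contDiff_fderiv_apply (contDiff_const (c := w))) (contDiff_e₁ ht hF hns)).continuous
  exact ((contDiff_pullθ hF _).continuous.mul (hl _)).sub
    ((contDiff_pullθ hF _).continuous.mul (hl _))

/-! ### Positivity of the area density. -/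

/-- The density of `θ ∧ e¹` is the Levi length of the unnormalised characteristic vector. -/
lemma areaDensity_eq (ht : t ^ 2 < 1) (hF : IsEmbeddedTorus F) {p : ℝ × ℝ}
    (hp : ¬ IsSingularPoint F p) : areaDensity t F p =
      √(levi t (F p) (fderiv ℝ F p (charDir F p)) (fderiv ℝ F p (charDir F p))) := by
  have hq := hF.mem_sphere p
  have hX : fderiv ℝ F p (charDir F p) = pullθ F p (1, 0) • fderiv ℝ F p (0, 1) -
      pullθ F p (0, 1) • fderiv ℝ F p (1, 0) := by
    rw [← map_smul, ← map_smul, ← map_sub]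
    congr 1
    ext <;> simp [charDir]
  -- Since `charDir` is `θ(F_x) ∂_y - θ(F_y) ∂_x`, linearity of `e¹` turns `(θ ∧ e¹)(F_x, F_y)` into
  -- `e¹` of its image.
  have h1 : areaDensity t F p = levi t (F p) (fderiv ℝ F p (charDir F p)) (e₁ t F p) := by
    simp only [areaDensity, dualE₁]
    rw [levi_eq ht hq (fderiv_mem_tangentSphere hF p _),
      levi_eq ht hq (fderiv_mem_tangentSphere hF p _),
      levi_eq ht hq (fderiv_mem_tangentSphere hF p _), hX, map_sub, map_smul, map_smul]
    simp [pullθ]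
    ring
  have hpos := levi_charDir_pos ht hF hp
  -- With `X` the image of `charDir`, `e₁ = X / |X|`, so `⟨X, e₁⟩ = |X|² / |X|`.
  have h2 : levi t (F p) (fderiv ℝ F p (charDir F p)) (e₁ t F p) =
      1 / √(levi t (F p) (fderiv ℝ F p (charDir F p)) (fderiv ℝ F p (charDir F p))) *
      levi t (F p) (fderiv ℝ F p (charDir F p)) (fderiv ℝ F p (charDir F p)) := by
    rw [e₁, e₁coord, map_smul, levi_eq ht hq (charDir_mem hF p).1]
    conv_rhs => rw [mul_comm]
    generalize 1 / √(levi t (F p) (fderiv ℝ F p (charDir F p)) (fderiv ℝ F p (charDir F p))) = r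
    rw [levi_eq ht hq (charDir_mem hF p).1, map_smul]
    simp
    ring
  rw [h1, h2, one_div, inv_mul_eq_div, Real.div_sqrt]

lemma areaDensity_pos (ht : t ^ 2 < 1) (hF : IsEmbeddedTorus F) {p : ℝ × ℝ}
    (hp : ¬ IsSingularPoint F p) : 0 < areaDensity t F p := by
  rw [areaDensity_eq ht hF hp]
  exact Real.sqrt_pos.mpr (levi_charDir_pos ht hF hp)

/-! ### The maximum of `α` on the torus. -/

/-- Every ingredient of `α` depends on `F` only through its value and first derivative at the point.
This includes the sign of `e₁`, on which the sign of `α` depends, so `α` descends to the torus. -/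
lemma α_add_of_periodic {c : ℝ × ℝ} (hc : ∀ p, F (p + c) = F p) (p : ℝ × ℝ) :
    α t F (p + c) = α t F p := by
  have hd : fderiv ℝ F (p + c) = fderiv ℝ F p := by
    rw [← fderiv_comp_add_right]
    congr 1
    exact funext hc
  simp only [α, e₂, e₁, e₁coord, charDir, transverse, pullθ, hd, hc]

/-- Periodicity makes a maximum over the closed square a maximum over the whole plane. Thus the
point is an interior local maximum even when it lies on the boundary of the square. -/
lemma exists_α_max (ht : t ^ 2 < 1) (hF : IsEmbeddedTorus F)
    (hns : ∀ p, ¬ IsSingularPoint F p) :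
    ∃ p ∈ Set.Icc (0 : ℝ) 1 ×ˢ Set.Icc (0 : ℝ) 1, ∀ p', α t F p' ≤ α t F p := by
  obtain ⟨p, hp, hmax⟩ := (isCompact_Icc.prod isCompact_Icc).exists_isMaxOn
    (s := Set.Icc (0 : ℝ) 1 ×ˢ Set.Icc (0 : ℝ) 1) ⟨(0, 0), by simp⟩
    (contDiff_α ht hF hns).continuous.continuousOn
  refine ⟨p, hp, fun ⟨x, y⟩ => ?_⟩
  have hx : ∀ y, Function.Periodic (fun x => α t F (x, y)) 1 := fun y x => by
    simpa using α_add_of_periodic (t := t) (c := (1, 0))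
      (fun p => by simpa [Prod.add_def] using hF.periodic_fst p.1 p.2) (x, y)
  have hy : ∀ x, Function.Periodic (fun y => α t F (x, y)) 1 := fun x y => by
    simpa using α_add_of_periodic (t := t) (c := (0, 1))
      (fun p => by simpa [Prod.add_def] using hF.periodic_snd p.1 p.2) (x, y)
  -- The point is moved into the unit square one coordinate at a time.
  obtain ⟨x', hx', hxx⟩ := (hx y).exists_mem_Ico₀ one_pos x
  obtain ⟨y', hy', hyy⟩ := (hy x').exists_mem_Ico₀ one_pos y
  have h : α t F (x, y) = α t F (x', y') := hxx.trans hyy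
  rw [h]
  exact hmax ⟨Set.Ico_subset_Icc_self hx', Set.Ico_subset_Icc_self hy'⟩

/-! ### From vanishing energy to pointwise vanishing of `Hcr`. -/

/-- If `E₁` vanishes, then so does `H_cr`. -/
lemma Hcr_eq_zero_of_E₁_eq_zero (ht : t ^ 2 < 1) (hF : IsEmbeddedTorus F)
    (hns : ∀ p, ¬ IsSingularPoint F p) (hE : E₁ t F = 0) {p : ℝ × ℝ}
    (hp : p ∈ Set.Icc (0 : ℝ) 1 ×ˢ Set.Icc (0 : ℝ) 1) : Hcr t F p = 0 := by
  have hcont : Continuous fun p => |Hcr t F p| ^ (3 / 2 : ℝ) * areaDensity t F p :=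
    ((continuous_Hcr ht hF hns).abs.rpow_const fun _ => Or.inr (by norm_num)).mul
      (continuous_areaDensity ht hF hns)
  have hint := hcont.continuousOn.integrableOn_compact (μ := volume)
    (isCompact_Icc.prod isCompact_Icc : IsCompact (Set.Icc (0 : ℝ) 1 ×ˢ Set.Icc (0 : ℝ) 1))
  have hae := (integral_eq_zero_iff_of_nonneg (fun p => mul_nonneg
    (Real.rpow_nonneg (abs_nonneg _) _) (areaDensity_pos ht hF (hns p)).le) hint).mp hE
  -- The integral only gives vanishing almost everywhere. As the square lies in the closure of its
  -- interior, continuity extends this to every point, including the boundary, where the maximum of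
  -- `α` may lie.
  have hsub : Set.Icc (0 : ℝ) 1 ×ˢ Set.Icc (0 : ℝ) 1 ⊆
      closure (interior (Set.Icc (0 : ℝ) 1 ×ˢ Set.Icc (0 : ℝ) 1)) := by
    rw [interior_prod_eq, closure_prod_eq, interior_Icc, closure_Ioo zero_ne_one]
  have h0 := Measure.eqOn_of_ae_eq hae hcont.continuousOn continuousOn_const hsub hp
  have h1 := (mul_eq_zero.mp h0).resolve_right (areaDensity_pos ht hF (hns p)).ne'
  exact abs_eq_zero.mp ((Real.rpow_eq_zero (abs_nonneg _) (by norm_num)).mp h1)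

lemma A₁₁_im (t : ℝ) : (A₁₁ t).im = 4 * t / (1 - t ^ 2) := by
  have h : A₁₁ t = ((4 * t / (1 - t ^ 2) : ℝ) : ℂ) * Complex.I := by
    simp only [A₁₁]
    push_cast
    ring
  rw [h, Complex.im_ofReal_mul, Complex.I_im, mul_one]

end Frame

end RossiSphere

theorem lemma5p3 (t : ℝ) (ht₀ : -1 < t) (ht₁ : t < 4 - √15)
    (F : ℝ × ℝ → ℂ × ℂ) (hF : RossiSphere.IsEmbeddedTorus F)
    (hns : ∀ p, ¬ RossiSphere.IsSingularPoint F p) :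
    RossiSphere.E₁ t F ≠ 0 := by
  intro hE
  have hs : √15 ^ 2 = 15 := Real.sq_sqrt (by norm_num)
  have hs0 : 0 ≤ √15 := Real.sqrt_nonneg 15
  -- This gives `4 - √15 < 1`, so the hypotheses on `t` imply `|t| < 1`.
  have hs3 : 3 < √15 := by nlinarith
  have ht : t ^ 2 < 1 := by nlinarith
  obtain ⟨p, hp, hmax⟩ := RossiSphere.exists_α_max ht hF hns
  have h0 := RossiSphere.Hcr_eq_zero_of_E₁_eq_zero ht hF hns hE hp
  have hd : fderiv ℝ (RossiSphere.α t F) p = 0 :=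
    IsLocalMax.fderiv_eq_zero (Filter.Eventually.of_forall hmax)
  have hc : 0 < 1 / 4 * RossiSphere.W t - (RossiSphere.A₁₁ t).im := by
    have he : 1 / 4 * RossiSphere.W t - (RossiSphere.A₁₁ t).im =
        (1 + t ^ 2 - 8 * t) / (2 * (1 - t ^ 2)) := by
      have : 1 - t ^ 2 ≠ 0 := by linarith
      rw [RossiSphere.A₁₁_im, RossiSphere.W]
      field_simp
      ring
    rw [he]
    -- The numerator is `(4 - t)² - 15`, positive because `4 - t > √15`.
    exact div_pos (by nlinarith) (by linarith)
  rw [RossiSphere.Hcr, hd, zero_apply] at h0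
  -- With the derivative term gone, `Hcr = 0` equates two nonnegative squares plus the positive
  -- constant of `hc` to zero.
  nlinarith [sq_nonneg (RossiSphere.α t F p), sq_nonneg (RossiSphere.H t F p)]
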